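/- Let $\Lambda\subset\mathbb R^d$ be a lattice (a discrete subgroup spanning $\mathbb R^d$) with a quantum spin $\mathbb C^q$, $q\ge 1$, at every site, and let $H=\sum_{x\in\Lambda}h_x$ be a Hamiltonian whose Hermitian terms are uniformly bounded, $\sup_x\|h_x\|<\infty$, each $h_x$ being supported within a fixed distance of $x$ (translation invariance is not required). Let $O_1,O_2$ be finitely supported operators. For $y\in\Lambda$, $O(y,0)$ denotes $O$ translated by $y$; $O(0,t)$ is the Heisenberg evolution of $O$ on the infinite lattice, i.e. the operator-norm limit of $e^{itH_V}Oe^{-itH_V}$, $H_V=\sum_{x\in V}h_x$, along the finite sets $V\subset\Lambda$ increasing to $\Lambda$. Let $\boldsymbol n\in\mathbb R^d$ be a unit vector. To give meaning to $O_2(x\boldsymbol n,0)$, let $X\subset\mathbb R$ be a set of admissible distances that is not bounded above, and for $x\in X$ let $p(x)\in\Lambda$ be a lattice vector representing $x\boldsymbol n$, with $\sup_{x\in X}|p(x)-x\boldsymbol n|<\infty$. (Examples: $X=\{x: x\boldsymbol n\in\Lambda\}$ and $p(x)=x\boldsymbol n$, if $\boldsymbol n$ is the direction of a nonzero lattice vector;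 or $X=\mathbb R$ and $p(x)$ a lattice point nearest to $x\boldsymbol n$, for any direction.) Put $$f(x,t)=\|[O_1(0,t),O_2(p(x),0)]\| ,\qquad x\in X .$$ Let $v^{(1)}_{\mathrm{LR}}\in[0,\infty]$ be the infimum of all $v>0$ for which there are $\xi,C>0$ such that $$f(x,t)\le C\,\|O_1\|\,\|O_2\|\,\min\{1,e^{(vt-x)/\xi}\}\quad\text{for all } t>0 \text{ and all } x\in X,\ x>0,$$ and let $v^{(2)}_{\mathrm{LR}}\in[0,\infty]$ be the supremum ($0$ if there are none) of all $v>0$ for which the limit $$\lim_{t\to\infty,\ vt\in X}\ \frac1t\ln f(vt,t)\in[-\infty,\infty]$$ exists and is $\ge 0$, where $\ln 0=-\infty$. Then: 1. the limit defining $O_1(0,t)$ exists for every $t\in\mathbb R$, and $v^{(1)}_{\mathrm{LR}}<\infty$; 2. $v^{(1)}_{\mathrm{LR}}\ge v^{(2)}_{\mathrm{LR}}$; 3. if, as $t\to\infty$ with $vt\in X$, $\frac1t\ln f(vt,t)$ converges to a limit $\lambda(v)\in[-\infty,\infty)$ uniformly for all $v>v^{(2)}_{\mathrm{LR}}$, then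 $v^{(1)}_{\mathrm{LR}}\le v^{(2)}_{\mathrm{LR}}$, hence $v^{(1)}_{\mathrm{LR}}=v^{(2)}_{\mathrm{LR}}$. Here uniform convergence is with respect to the uniformity of $[-\infty,\infty)$ in which $a,b$ are $\varepsilon$-close if $a\le\max(b+\varepsilon,-1/\varepsilon)$ and $b\le\max(a+\varepsilon,-1/\varepsilon)$; for finite values it is implied by uniform convergence in the usual sense, $\sup_v|\frac1t\ln f(vt,t)-\lambda(v)|\to0$. -/

import Mathlib

open Filter Topology

noncomputable section

namespace SpinLattice

/-- Physical space `ℝᵈ` with the Euclidean norm. -/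
abbrev Space (d : ℕ) : Type := EuclideanSpace ℝ (Fin d)

variable {d : ℕ} (Λ : Submodule ℤ (Space d)) (q : ℕ) [NeZero q]

/-- Spin configurations on the lattice `Λ` with `q` states per site which differ from the reference
configuration (all spins in state `0`) at finitely many sites. -/
abbrev Config : Type := Λ →₀ Fin q

/-- The infinite tensor product of the one-site spaces `ℂ^q` along the reference configuration:
its orthonormal basis is indexed by `Config Λ q`. -/
abbrev HilbertSp : Type := lp (fun _ : Config Λ q => ℂ) 2

/-- Bounded operators, with the operator norm. They contain the local operators of the lattice,
and the norm closure of the latter is the quasi-local algebra. -/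
abbrev Op : Type := HilbertSp Λ q →L[ℂ] HilbertSp Λ q

variable {Λ q}

open Classical in
/-- The basis vector of a configuration. -/
def ket (τ : Config Λ q) : HilbertSp Λ q := lp.single 2 τ (1 : ℂ)

/-- The matrix element `⟨σ| A |τ⟩`. -/
def matrixElement (A : Op Λ q) (σ τ : Config Λ q) : ℂ := A (ket τ) σ

/-- `A` is supported on the set of sites `S`, i.e. it is of the form `a ⊗ 1` with `a` acting on the
sites in `S`: its matrix elements vanish between configurations that differ outside `S`, and
otherwise they depend only on the restrictions of the two configurations to `S`. -/
def IsSupportedOn (S : Set Λ) (A : Op Λ q) : Prop :=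
  (∀ σ τ : Config Λ q, (∃ x, x ∉ S ∧ σ x ≠ τ x) → matrixElement A σ τ = 0) ∧
  (∀ σ τ σ' τ' : Config Λ q, (∀ x, x ∉ S → σ x = τ x) → (∀ x, x ∉ S → σ' x = τ' x) →
    (∀ x, x ∈ S → σ x = σ' x) → (∀ x, x ∈ S → τ x = τ' x) →
    matrixElement A σ τ = matrixElement A σ' τ')

/-- Operators supported on finitely many sites. -/
def IsLocal (A : Op Λ q) : Prop := ∃ S : Finset Λ, IsSupportedOn (S : Set Λ) A

/-- Relabelling the basis by a permutation `e` of the configurations: `(U ψ)(σ) = ψ (e σ)`. -/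
def permute (e : Equiv.Perm (Config Λ q)) : HilbertSp Λ q ≃ₗᵢ[ℂ] HilbertSp Λ q :=
  have mem : ∀ (e : Equiv.Perm (Config Λ q)) (ψ : HilbertSp Λ q),
      Memℓp (fun σ => ψ (e σ)) 2 := fun e ψ =>
    memℓp_gen (((lp.memℓp ψ).summable (by norm_num)).comp_injective e.injective)
  { toFun := fun ψ => ⟨fun σ => ψ (e σ), mem e ψ⟩
    invFun := fun ψ => ⟨fun σ => ψ (e.symm σ), mem e.symm ψ⟩
    map_add' := fun _ _ => rfl
    map_smul' := fun _ _ => rfl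
    left_inv := fun ψ => by ext σ; simp
    right_inv := fun ψ => by ext σ; simp
    norm_map' := fun ψ => by
      rw [lp.norm_eq_tsum_rpow (by norm_num), lp.norm_eq_tsum_rpow (by norm_num)]
      congr 1
      exact Equiv.tsum_eq e (fun σ => ‖ψ σ‖ ^ (2 : ENNReal).toReal) }

/-- The configuration shifted by `-y`, i.e. `x ↦ σ (x + y)`. -/
def shiftConfig (y : Λ) : Equiv.Perm (Config Λ q) :=
  Finsupp.equivCongrLeft (Equiv.subRight y)

/-- The unitary translation by the lattice vector `y`: it maps the basis vector of `σ` to the basis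
vector of `x ↦ σ (x - y)`. -/
def translation (y : Λ) : HilbertSp Λ q ≃ₗᵢ[ℂ] HilbertSp Λ q := permute (shiftConfig y)

/-- The operator `A` translated in space by the lattice vector `y`. -/
def translate (y : Λ) (A : Op Λ q) : Op Λ q :=
  ((translation (q := q) y).toContinuousLinearEquiv : Op Λ q) * A *
    ((translation (q := q) y).symm.toContinuousLinearEquiv : Op Λ q)

variable (Λ q) in
/-- A local Hamiltonian `H = ∑ₓ hₓ`: uniformly bounded Hermitian terms, `hₓ` being supported within
distance `range` from the site `x`. Translation invariance is not required. -/
structure Hamiltonian where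
  /-- the local terms -/
  term : Λ → Op Λ q
  /-- the interaction range -/
  range : ℝ
  selfAdjoint : ∀ x, IsSelfAdjoint (term x)
  supported : ∀ x, IsSupportedOn {y | dist y x < range} (term x)
  bounded : ∃ J : ℝ, ∀ x, ‖term x‖ ≤ J

/-- The Hamiltonian of the finite subsystem `V`. -/
def Hamiltonian.restrict (H : Hamiltonian Λ q) (V : Finset Λ) : Op Λ q := ∑ x ∈ V, H.term x

/-- Heisenberg evolution `e^{i t H_V} A e^{-i t H_V}` with the Hamiltonian of the finite
subsystem `V`. -/
def Hamiltonian.evolveIn (H : Hamiltonian Λ q) (V : Finset Λ) (t : ℝ) (A : Op Λ q) : Op Λ q :=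
  NormedSpace.exp ((Complex.I * (t : ℂ)) • H.restrict V) * A *
    NormedSpace.exp (-((Complex.I * (t : ℂ)) • H.restrict V))

/-- Heisenberg evolution on the infinite lattice: the operator norm limit of the evolutions of
increasing finite subsystems. -/
def Hamiltonian.evolve (H : Hamiltonian Λ q) (t : ℝ) (A : Op Λ q) : Op Λ q :=
  limUnder atTop (fun V : Finset Λ => H.evolveIn V t A)

/-- The commutator `[O₁(0, t), O₂(y, 0)]`. -/
def Hamiltonian.commutator (H : Hamiltonian Λ q) (O₁ O₂ : Op Λ q) (t : ℝ) (y : Λ) : Op Λ q :=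
  H.evolve t O₁ * translate y O₂ - translate y O₂ * H.evolve t O₁

section Velocities

/- In the following `X` is a set of distances along a ray and `p x`, for `x ∈ X`, is the lattice
vector which represents the point at distance `x` from the origin on the ray. -/
variable (H : Hamiltonian Λ q) (X : Set ℝ) (p : ℝ → Λ) (O₁ O₂ : Op Λ q)

/-- The velocity `v` admits an exponential Lieb-Robinson bound along the ray. -/
def LiebRobinsonBound (v : ℝ) : Prop :=
  ∃ ξ C : ℝ, 0 < ξ ∧ 0 < C ∧ ∀ t x : ℝ, 0 < t → 0 < x → x ∈ X →
    ‖H.commutator O₁ O₂ t (p x)‖ ≤ C * ‖O₁‖ * ‖O₂‖ * min 1 (Real.exp ((v * t - x) / ξ))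

/-- The infimum (in `[0, ∞]`, with `inf ∅ = ∞`) of the velocities `v > 0` which admit an exponential
Lieb-Robinson bound. -/
def velocity₁ : ENNReal :=
  ⨅ v ∈ {v : ℝ | 0 < v ∧ LiebRobinsonBound H X p O₁ O₂ v}, ENNReal.ofReal v

/-- The growth rate `t⁻¹ ln ‖[O₁(0, t), O₂(p (v t), 0)]‖` at time `t`, with `ln 0 = -∞`. -/
def growthRate (v t : ℝ) : EReal :=
  ((t⁻¹ : ℝ) : EReal) * ENNReal.log ‖H.commutator O₁ O₂ t (p (v * t))‖ₑ

/-- The limit of the growth rate along the ray `x = v t`, as `t → ∞` with `v t ∈ X`, exists and is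
equal to `l`. -/
def HasRayLimit (v : ℝ) (l : EReal) : Prop :=
  Tendsto (growthRate H p O₁ O₂ v) (atTop ⊓ 𝓟 {t | v * t ∈ X}) (𝓝 l)

/-- The supremum (in `[0, ∞]`, with `sup ∅ = 0`) of the velocities `v > 0` along whose ray the limit
of the growth rate is nonnegative. -/
def velocity₂ : ENNReal :=
  ⨆ v ∈ {v : ℝ | 0 < v ∧ ∃ l : EReal, HasRayLimit H X p O₁ O₂ v l ∧ 0 ≤ l}, ENNReal.ofReal v

/-- The growth rate converges to `lam v`, as `t → ∞` with `v t ∈ X`, uniformly for `v ∈ W`.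
Rates take values in `[-∞, ∞)`, where `a` and `b` are `ε`-close if `a ≤ max (b + ε) (-1/ε)` and
`b ≤ max (a + ε) (-1/ε)`; these relations form a basis of the uniformity of `[-∞, ∞)` with the
neighbourhoods `[-∞, -1/ε]` of `-∞`. They follow from `|a - b| ≤ ε` for finite `a` and `b`. -/
def UniformRayLimit (W : Set ℝ) (lam : ℝ → EReal) : Prop :=
  ∀ ε : ℝ, 0 < ε → ∃ T : ℝ, 0 < T ∧ ∀ t : ℝ, T ≤ t → ∀ v ∈ W, v * t ∈ X →
    growthRate H p O₁ O₂ v t ≤ max (lam v + (ε : EReal)) ((-1 / ε : ℝ) : EReal) ∧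
    lam v ≤ max (growthRate H p O₁ O₂ v t + (ε : EReal)) ((-1 / ε : ℝ) : EReal)

end Velocities

end SpinLattice

end

/-! Everything rests on a Lieb-Robinson bound uniform in the finite volume. When `⁅A, τ_s(B)⁆` is
differentiated in `s`, the part of the Hamiltonian commuting with `A` only rotates it unitarily, so
its norm grows at a rate controlled by the terms near the support of `A`. Applied to all terms `h_z`
together with weights `exp ‖z‖`, this closes a Gronwall inequality and gives decay `exp (K|t| -
‖z‖)`. The decay is summable over the lattice, so Duhamel's formula yields the infinite-volume
evolution; one more use of the derivative, with `A` the translate of `O₂`, bounds the commutator and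
makes `velocity₁` finite.

A bound with velocity `v` forces a negative rate along every faster ray, hence `velocity₂ ≤
velocity₁`.

For the converse, the limiting rate is negative at each velocity above `velocity₂`, but must be
bounded away from zero. Neighbouring rays pass through the same point `x` at nearby times, and the
commutator at fixed `x` is continuous in time; uniform convergence carries a negative rate at one
finite time over to the limits on all nearby rays (`exists_eventually_rate_le`). Compactness then
treats velocities in `[v, 2 v₀]`, and the a priori bound with velocity `v₀` treats the rest. -/

noncomputable section

namespace SpinLattice

/-! ### Heisenberg evolution in a C⋆-algebra -/

section Dynamics

variable {𝔸 : Type*} [CStarAlgebra 𝔸]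

/-- The Heisenberg evolution `e^{i t H} A e^{-i t H}` generated by `H`. -/
def heisenberg (H : 𝔸) (t : ℝ) (A : 𝔸) : 𝔸 :=
  NormedSpace.exp ((Complex.I * (t : ℂ)) • H) * A *
    NormedSpace.exp (-((Complex.I * (t : ℂ)) • H))

theorem norm_lie_le (A B : 𝔸) : ‖⁅A, B⁆‖ ≤ 2 * ‖A‖ * ‖B‖ := by
  rw [Ring.lie_def]
  have h₁ := norm_mul_le A B
  have h₂ := norm_mul_le B A
  have h₃ := norm_sub_le (A * B) (B * A)
  nlinarith

theorem norm_lie_comm (A B : 𝔸) : ‖⁅A, B⁆‖ = ‖⁅B, A⁆‖ := by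
  rw [Ring.lie_def, Ring.lie_def, norm_sub_rev]

theorem exp_I_smul_mem_unitary {H : 𝔸} (hH : IsSelfAdjoint H) (t : ℝ) :
    NormedSpace.exp ((Complex.I * (t : ℂ)) • H) ∈ unitary 𝔸 := by
  have h : IsSelfAdjoint ((t : ℂ) • H) := by
    rw [isSelfAdjoint_iff, star_smul, hH.star_eq]
    simp
  have := (selfAdjoint.expUnitary (⟨(t : ℂ) • H, h⟩ : selfAdjoint 𝔸)).2
  rwa [selfAdjoint.expUnitary_coe, smul_smul] at this

theorem exp_neg_I_smul_mem_unitary {H : 𝔸} (hH : IsSelfAdjoint H) (t : ℝ) :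
    NormedSpace.exp (-((Complex.I * (t : ℂ)) • H)) ∈ unitary 𝔸 := by
  have := exp_I_smul_mem_unitary hH (-t)
  simpa using this

@[simp]
theorem norm_heisenberg {H : 𝔸} (hH : IsSelfAdjoint H) (t : ℝ) (A : 𝔸) :
    ‖heisenberg H t A‖ = ‖A‖ := by
  rw [heisenberg, CStarRing.norm_mul_mem_unitary _ (exp_neg_I_smul_mem_unitary hH t),
    CStarRing.norm_mem_unitary_mul _ (exp_I_smul_mem_unitary hH t)]

theorem heisenberg_neg (H : 𝔸) (t : ℝ) (A : 𝔸) :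
    heisenberg (-H) t A = heisenberg H (-t) A := by
  simp [heisenberg]

@[simp]
theorem heisenberg_zero (H A : 𝔸) : heisenberg H 0 A = A := by
  simp [heisenberg]

theorem heisenberg_sub (H : 𝔸) (t : ℝ) (A B : 𝔸) :
    heisenberg H t (A - B) = heisenberg H t A - heisenberg H t B := by
  simp [heisenberg, mul_sub, sub_mul]

theorem heisenberg_neg_heisenberg (H : 𝔸) (t : ℝ) (A : 𝔸) :
    heisenberg (-H) t (heisenberg H t A) = A := by
  let _ : NormedAlgebra ℚ 𝔸 := .restrictScalars ℚ ℂ 𝔸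
  set X := (Complex.I * (t : ℂ)) • H
  have h₁ : NormedSpace.exp (-X) * NormedSpace.exp X = 1 := by
    rw [← NormedSpace.exp_add_of_commute (Commute.neg_left (Commute.refl X)), neg_add_cancel,
      NormedSpace.exp_zero]
  simp only [heisenberg, smul_neg, neg_neg]
  change NormedSpace.exp (-X) * (NormedSpace.exp X * A * NormedSpace.exp (-X)) *
    NormedSpace.exp X = A
  calc _ = NormedSpace.exp (-X) * NormedSpace.exp X * A *
        (NormedSpace.exp (-X) * NormedSpace.exp X) := by noncomm_ring
    _ = A := by rw [h₁, one_mul, mul_one]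

/-- Product rule in the interaction picture; the other derivative formulas are instances of it. -/
theorem hasDerivAt_heisenberg_comp (K : 𝔸) {F : ℝ → 𝔸} {F' : 𝔸} {s : ℝ}
    (hF : HasDerivAt F F' s) :
    HasDerivAt (fun r => heisenberg K r (F r))
      (heisenberg K s (F' + Complex.I • ⁅K, F s⁆)) s := by
  have e : ∀ r : ℝ, (Complex.I * (r : ℂ)) • K = r • (Complex.I • K) := fun r => by
    rw [mul_comm, mul_smul, Complex.coe_smul]
  have h₁ := hasDerivAt_exp_smul_const (𝕂 := ℝ) (Complex.I • K) s
  have h₂ := hasDerivAt_exp_smul_const' (𝕂 := ℝ) (-(Complex.I • K)) s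
  have h := (h₁.mul hF).mul h₂
  simp only [heisenberg, e]
  have key : ∀ U V x y : 𝔸, (U * (Complex.I • K) * x + U * y) * V +
      U * x * (-(Complex.I • K) * V) = U * (y + Complex.I • ⁅K, x⁆) * V := fun U V x y => by
    rw [Ring.lie_def, smul_sub, ← smul_mul_assoc, ← mul_smul_comm]
    noncomm_ring
  rw [← key]
  simp only [smul_neg] at h
  convert h using 1 <;> rfl

theorem hasDerivAt_heisenberg (H A : 𝔸) (s : ℝ) :
    HasDerivAt (fun r => heisenberg H r A) (heisenberg H s (Complex.I • ⁅H, A⁆)) s := by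
  simpa using hasDerivAt_heisenberg_comp H (hasDerivAt_const s A)

theorem lie_heisenberg (H A : 𝔸) (s : ℝ) :
    ⁅H, heisenberg H s A⁆ = heisenberg H s ⁅H, A⁆ := by
  have h : Commute H ((Complex.I * (s : ℂ)) • H) := (Commute.refl H).smul_right _
  have h₁ : H * NormedSpace.exp ((Complex.I * (s : ℂ)) • H) = _ := h.exp_right.eq
  have h₂ : H * NormedSpace.exp (-((Complex.I * (s : ℂ)) • H)) = _ := h.neg_right.exp_right.eq
  rw [Ring.lie_def, Ring.lie_def, heisenberg, heisenberg, mul_sub, sub_mul]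
  congr 1
  · rw [← mul_assoc, ← mul_assoc, h₁]; simp only [mul_assoc]
  · simp only [mul_assoc, h₂]

theorem hasDerivAt_heisenberg' (H A : 𝔸) (s : ℝ) :
    HasDerivAt (fun r => heisenberg H r A) (Complex.I • ⁅H, heisenberg H s A⁆) s := by
  refine (hasDerivAt_heisenberg H A s).congr_deriv ?_
  rw [lie_heisenberg, heisenberg, heisenberg, mul_smul_comm, smul_mul_assoc]

/-- Duhamel's interpolation: undoing the `H`-evolution with `K` leaves a derivative that sees only
`H - K`. -/
theorem hasDerivAt_heisenberg_heisenberg (H K A : 𝔸) (s : ℝ) :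
    HasDerivAt (fun r => heisenberg (-K) r (heisenberg H r A))
      (heisenberg (-K) s (Complex.I • ⁅H - K, heisenberg H s A⁆)) s := by
  refine (hasDerivAt_heisenberg_comp (-K) (hasDerivAt_heisenberg' H A s)).congr_deriv ?_
  rw [← smul_add]
  simp only [Ring.lie_def]
  congr 2
  noncomm_ring

/-- If `A` commutes with `H - K`, then the commutator of `A` with the evolution of `B` under `H`
only changes due to `K`, up to a unitary rotation. -/
theorem hasDerivAt_heisenberg_lie {H K A : 𝔸} (B : 𝔸) (hA : ⁅A, H - K⁆ = 0) (s : ℝ) :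
    HasDerivAt (fun r => heisenberg (-(H - K)) r ⁅A, heisenberg H r B⁆)
      (heisenberg (-(H - K)) s (Complex.I • ⁅A, ⁅K, heisenberg H s B⁆⁆)) s := by
  have hB := hasDerivAt_heisenberg' H B s
  have h := hasDerivAt_heisenberg_comp (-(H - K)) ((hB.const_mul A).sub (hB.mul_const A))
  refine h.congr_deriv ?_
  congr 1
  change A * (Complex.I • ⁅H, heisenberg H s B⁆) - Complex.I • ⁅H, heisenberg H s B⁆ * A +
    Complex.I • ⁅-(H - K), ⁅A, heisenberg H s B⁆⁆ = _
  generalize heisenberg H s B = b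
  rw [mul_smul_comm, smul_mul_assoc, ← smul_sub, ← smul_add]
  congr 1
  simp only [Ring.lie_def] at hA ⊢
  -- Jacobi identity, arranged so that what remains besides `⁅A, ⁅K, b⁆⁆` contains `⁅A, H - K⁆`.
  have key : A * (H * b - b * H) - (H * b - b * H) * A +
      (-(H - K) * (A * b - b * A) - (A * b - b * A) * -(H - K)) =
      A * (K * b - b * K) - (K * b - b * K) * A +
      ((A * (H - K) - (H - K) * A) * b - b * (A * (H - K) - (H - K) * A)) := by
    noncomm_ring
  rw [key, hA, zero_mul, mul_zero, sub_zero, add_zero]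

theorem norm_hasDerivAt_heisenberg_lie_le {H K : 𝔸} (hH : IsSelfAdjoint H) (hK : IsSelfAdjoint K)
    (A B : 𝔸) (s : ℝ) :
    ‖heisenberg (-(H - K)) s (Complex.I • ⁅A, ⁅K, heisenberg H s B⁆⁆)‖ ≤
      2 * ‖A‖ * ‖⁅K, heisenberg H s B⁆‖ := by
  rw [norm_heisenberg (hH.sub hK).neg, norm_smul, Complex.norm_I, one_mul]
  exact norm_lie_le _ _

end Dynamics

/-! ### Supports of operators and locality -/

section Support

variable {d : ℕ} {Λ : Submodule ℤ (Space d)} {q : ℕ} [NeZero q]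

open Classical in
theorem ket_apply (τ σ : Config Λ q) : ket τ σ = if σ = τ then 1 else 0 := by
  rw [ket, lp.single_apply, Pi.single_apply]

theorem hasSum_ket (ψ : HilbertSp Λ q) : HasSum (fun τ => ψ τ • ket τ) ψ := by
  classical
  have h := lp.hasSum_single (p := 2) (by norm_num) ψ
  convert h using 2 with τ
  rw [ket, ← lp.single_smul, smul_eq_mul, mul_one]

theorem op_ext {A B : Op Λ q} (h : ∀ σ τ, matrixElement A σ τ = matrixElement B σ τ) :
    A = B := by
  ext1 ψ
  have hk : ∀ τ, A (ket τ) = B (ket τ) := fun τ => by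
    ext σ
    exact h σ τ
  have h₁ := (hasSum_ket ψ).mapL A
  have h₂ := (hasSum_ket ψ).mapL B
  refine h₁.unique ?_
  convert h₂ using 2 with τ
  rw [A.map_smul, B.map_smul, hk]

theorem hasSum_matrixElement_mul (A B : Op Λ q) (σ τ : Config Λ q) :
    HasSum (fun ρ => matrixElement A σ ρ * matrixElement B ρ τ) (matrixElement (A * B) σ τ) := by
  have h := ((hasSum_ket (B (ket τ))).mapL A).mapL (lp.evalCLM ℂ (fun _ : Config Λ q => ℂ) 2 σ)
  have e : ∀ ρ, matrixElement A σ ρ * matrixElement B ρ τ =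
      lp.evalCLM ℂ (fun _ : Config Λ q => ℂ) 2 σ (A (B (ket τ) ρ • ket ρ)) := fun ρ => by
    rw [A.map_smul]
    exact mul_comm _ _
  simp only [e]
  exact h

open Classical in
/-- The configuration which agrees with `σ` on `S` and with `τ` elsewhere. -/
def splice (S : Set Λ) (σ τ : Config Λ q) : Config Λ q :=
  Finsupp.onFinset (σ.support ∪ τ.support) (fun x => if x ∈ S then σ x else τ x) (by
    intro x hx
    simp only [Finset.mem_union, Finsupp.mem_support_iff]
    by_contra! h
    simp [h.1, h.2] at hx)

theorem splice_of_mem {S : Set Λ} (σ τ : Config Λ q) {x : Λ} (hx : x ∈ S) :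
    splice S σ τ x = σ x := by simp [splice, hx]

theorem splice_of_notMem {S : Set Λ} (σ τ : Config Λ q) {x : Λ} (hx : x ∉ S) :
    splice S σ τ x = τ x := by simp [splice, hx]

/-- Only one intermediate configuration contributes: it must agree with `σ` off `S` and with `τ` off
`T`, which determines it because every site lies off `S` or off `T`. -/
theorem matrixElement_mul_of_disjoint {S T : Set Λ} (hST : Disjoint S T) {A B : Op Λ q}
    (hA : IsSupportedOn S A) (hB : IsSupportedOn T B) (σ τ : Config Λ q) :
    matrixElement (A * B) σ τ =
      matrixElement A σ (splice T σ τ) * matrixElement B (splice T σ τ) τ := by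
  refine (hasSum_matrixElement_mul A B σ τ).unique (hasSum_single _ fun ρ hρ => ?_)
  by_contra hne
  rw [mul_eq_zero, not_or] at hne
  refine hρ (Finsupp.ext fun x => ?_)
  have h₁ : x ∉ S → σ x = ρ x := fun hx => by
    by_contra h
    exact hne.1 (hA.1 _ _ ⟨x, hx, h⟩)
  have h₂ : x ∉ T → ρ x = τ x := fun hx => by
    by_contra h
    exact hne.2 (hB.1 _ _ ⟨x, hx, h⟩)
  by_cases hx : x ∈ T
  · rw [splice_of_mem _ _ hx, h₁ fun hS => Set.disjoint_left.1 hST hS hx]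
  · rw [splice_of_notMem _ _ hx, h₂ hx]

/-- Operators with disjoint supports commute. -/
theorem lie_eq_zero_of_disjoint {S T : Set Λ} (hST : Disjoint S T) {A B : Op Λ q}
    (hA : IsSupportedOn S A) (hB : IsSupportedOn T B) : ⁅A, B⁆ = 0 := by
  rw [Ring.lie_def, sub_eq_zero]
  refine op_ext fun σ τ => ?_
  rw [matrixElement_mul_of_disjoint hST hA hB, matrixElement_mul_of_disjoint hST.symm hB hA,
    mul_comm]
  have hS : ∀ x ∈ S, x ∉ T := fun x hx => Set.disjoint_left.1 hST hx
  -- If `σ` and `τ` differ outside `S ∪ T`, both products vanish; otherwise the factors match in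
  -- pairs.
  by_cases h : ∀ x, x ∉ S → x ∉ T → σ x = τ x
  · have hA' : ∀ x, x ∉ S → σ x = splice T σ τ x := fun x hx => by
      by_cases hT : x ∈ T
      · rw [splice_of_mem _ _ hT]
      · rw [splice_of_notMem _ _ hT, h x hx hT]
    have hB' : ∀ x, x ∉ T → σ x = splice S σ τ x := fun x hx => by
      by_cases hs : x ∈ S
      · rw [splice_of_mem _ _ hs]
      · rw [splice_of_notMem _ _ hs, h x hs hx]
    congr 1
    · refine hB.2 _ _ _ _ (fun x hx => splice_of_notMem _ _ hx) hB'
        (fun x hx => splice_of_mem _ _ hx) fun x hx => ?_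
      rw [splice_of_notMem _ _ fun hs => hS x hs hx]
    · refine hA.2 _ _ _ _ hA' (fun x hx => splice_of_notMem _ _ hx)
        (fun x hx => (splice_of_mem _ _ hx).symm) fun x hx => ?_
      rw [splice_of_notMem _ _ (hS x hx)]
  · push Not at h
    obtain ⟨x, hxS, hxT, hne⟩ := h
    rw [hA.1 σ (splice T σ τ) ⟨x, hxS, by rwa [splice_of_notMem _ _ hxT]⟩,
      hB.1 σ (splice S σ τ) ⟨x, hxT, by rwa [splice_of_notMem _ _ hxS]⟩]
    simp

theorem IsSupportedOn.mono {S T : Set Λ} (hST : S ⊆ T) {A : Op Λ q} (hA : IsSupportedOn S A) :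
    IsSupportedOn T A := by
  refine ⟨fun σ τ ⟨x, hx, hne⟩ => hA.1 σ τ ⟨x, fun h => hx (hST h), hne⟩,
    fun σ τ σ' τ' h₁ h₂ h₃ h₄ => ?_⟩
  by_cases h : ∀ x, x ∉ S → σ x = τ x
  · refine hA.2 σ τ σ' τ' h (fun x hx => ?_) (fun x hx => h₃ x (hST hx))
      fun x hx => h₄ x (hST hx)
    by_cases hT : x ∈ T
    · rw [← h₃ x hT, ← h₄ x hT, h x hx]
    · exact h₂ x hT
  · push Not at h
    obtain ⟨x, hx, hne⟩ := h
    have hT : x ∈ T := by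
      by_contra hT
      exact hne (h₁ x hT)
    rw [hA.1 σ τ ⟨x, hx, hne⟩, hA.1 σ' τ' ⟨x, hx, by rwa [← h₃ x hT, ← h₄ x hT]⟩]

theorem IsLocal.exists_norm_le {A : Op Λ q} (hA : IsLocal A) :
    ∃ r : ℝ, IsSupportedOn {x : Λ | ‖x‖ ≤ r} A := by
  obtain ⟨S, hS⟩ := hA
  obtain ⟨r, hr⟩ := (S.image fun x => ‖x‖).bddAbove
  exact ⟨r, hS.mono fun x hx => hr (Finset.mem_coe.2 (Finset.mem_image_of_mem _ hx))⟩

theorem shiftConfig_apply (y : Λ) (σ : Config Λ q) (x : Λ) : shiftConfig y σ x = σ (x + y) := rfl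

theorem translation_symm_ket (y : Λ) (τ : Config Λ q) :
    (translation y).symm (ket τ) = ket (shiftConfig y τ) := by
  rw [LinearIsometryEquiv.symm_apply_eq]
  ext σ
  change ket τ σ = ket (shiftConfig y τ) (shiftConfig y σ)
  simp [ket_apply]

theorem matrixElement_translate (y : Λ) (A : Op Λ q) (σ τ : Config Λ q) :
    matrixElement (translate y A) σ τ = matrixElement A (shiftConfig y σ) (shiftConfig y τ) := by
  change (translation y (A ((translation y).symm (ket τ)))) σ = _
  rw [translation_symm_ket]
  rfl

theorem IsSupportedOn.translate {S : Set Λ} {A : Op Λ q} (hA : IsSupportedOn S A) (y : Λ) :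
    IsSupportedOn {x | x - y ∈ S} (translate y A) := by
  refine ⟨fun σ τ ⟨x, hx, hne⟩ => ?_, fun σ τ σ' τ' h₁ h₂ h₃ h₄ => ?_⟩
  · rw [matrixElement_translate]
    exact hA.1 _ _ ⟨x - y, hx, by simpa [shiftConfig_apply] using hne⟩
  · rw [matrixElement_translate, matrixElement_translate]
    refine hA.2 _ _ _ _ (fun x hx => ?_) (fun x hx => ?_) (fun x hx => ?_) fun x hx => ?_ <;>
      simp only [shiftConfig_apply]
    · exact h₁ _ (by simpa using hx)
    · exact h₂ _ (by simpa using hx)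
    · exact h₃ _ (by simpa using hx)
    · exact h₄ _ (by simpa using hx)

theorem norm_translate_le (y : Λ) (A : Op Λ q) : ‖translate y A‖ ≤ ‖A‖ := by
  refine ContinuousLinearMap.opNorm_le_bound _ (norm_nonneg _) fun ψ => ?_
  change ‖translation y (A ((translation y).symm ψ))‖ ≤ _
  rw [LinearIsometryEquiv.norm_map]
  refine (A.le_opNorm _).trans ?_
  rw [LinearIsometryEquiv.norm_map]

end Support

/-! ### Finite-volume Lieb-Robinson bound -/

section LiebRobinson

variable {d : ℕ} {Λ : Submodule ℤ (Space d)} {q : ℕ} [NeZero q]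

theorem lie_sum_eq {ι : Type*} (A : Op Λ q) (s : Finset ι) (f : ι → Op Λ q) :
    ⁅A, ∑ i ∈ s, f i⁆ = ∑ i ∈ s, ⁅A, f i⁆ := by
  simp only [Ring.lie_def, Finset.mul_sum, Finset.sum_mul, Finset.sum_sub_distrib]

theorem norm_sum_lie_le {ι : Type*} (s : Finset ι) (f : ι → Op Λ q) (A : Op Λ q) :
    ‖⁅∑ i ∈ s, f i, A⁆‖ ≤ ∑ i ∈ s, ‖⁅f i, A⁆‖ := by
  rw [norm_lie_comm, lie_sum_eq]
  refine (norm_sum_le _ _).trans_eq (Finset.sum_congr rfl fun i _ => norm_lie_comm _ _)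

theorem Hamiltonian.isSelfAdjoint_restrict (H : Hamiltonian Λ q) (V : Finset Λ) :
    IsSelfAdjoint (H.restrict V) :=
  isSelfAdjoint_sum V fun x _ => H.selfAdjoint x

/-- The Hamiltonian with the opposite sign, which generates the time-reversed evolution. -/
def Hamiltonian.neg (H : Hamiltonian Λ q) : Hamiltonian Λ q where
  term x := -H.term x
  range := H.range
  selfAdjoint x := (H.selfAdjoint x).neg
  supported x := by
    have e : ∀ σ τ, matrixElement (-H.term x) σ τ = -matrixElement (H.term x) σ τ :=
      fun _ _ => rfl
    refine ⟨fun σ τ h => ?_, fun σ τ σ' τ' h₁ h₂ h₃ h₄ => ?_⟩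
    · rw [e, (H.supported x).1 σ τ h, neg_zero]
    · rw [e, e, (H.supported x).2 σ τ σ' τ' h₁ h₂ h₃ h₄]
  bounded := by simpa using H.bounded

theorem Hamiltonian.restrict_neg (H : Hamiltonian Λ q) (V : Finset Λ) :
    H.neg.restrict V = -H.restrict V :=
  Finset.sum_neg_distrib _

open Classical in
/-- The terms of the Hamiltonian which do not meet the support of `A` commute with `A`. -/
theorem Hamiltonian.lie_restrict_sub_filter (H : Hamiltonian Λ q) (V : Finset Λ) {A : Op Λ q}
    {S : Set Λ} (hA : IsSupportedOn S A) (P : Λ → Prop)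
    (hP : ∀ z, ¬ P z → Disjoint S {y | dist y z < H.range}) :
    ⁅A, H.restrict V - H.restrict (V.filter P)⁆ = 0 := by
  have h : H.restrict V - H.restrict (V.filter P) = ∑ z ∈ V with ¬ P z, H.term z := by
    rw [sub_eq_iff_eq_add', restrict, restrict, Finset.sum_filter_add_sum_filter_not]
  rw [h, lie_sum_eq]
  exact Finset.sum_eq_zero fun z hz =>
    lie_eq_zero_of_disjoint (hP z (Finset.mem_filter.1 hz).2) hA (H.supported z)

-- Gronwall in the sup norm over sites: the weights `exp ‖z‖` turn the coupled inequalities for all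
-- `⁅h_z, τ_s(B)⁆` into one, with a rate `2JN` independent of `V`.
open Classical in
theorem Hamiltonian.norm_lie_term_heisenberg_le_of_nonneg (H : Hamiltonian Λ q) {J N r : ℝ}
    (hJ : ∀ z, ‖H.term z‖ ≤ J) (hN₀ : 0 ≤ N) (hN : ∀ (V : Finset Λ) (z : Λ),
      ∑ w ∈ V with dist z w < 2 * H.range, Real.exp (-‖w‖) ≤ N * Real.exp (-‖z‖))
    {B : Op Λ q} (hB : IsSupportedOn {x : Λ | ‖x‖ ≤ r} B) (V : Finset Λ) {t : ℝ} (ht : 0 ≤ t)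
    (z : Λ) :
    ‖⁅H.term z, heisenberg (H.restrict V) t B⁆‖ ≤
      2 * J * Real.exp (H.range + r) * ‖B‖ * Real.exp (2 * J * N * t - ‖z‖) := by
  have hJ₀ : 0 ≤ J := (norm_nonneg _).trans (hJ z)
  -- The site `z` of interest need not lie in `V`.
  set I : Finset Λ := insert z V
  set near : Λ → Op Λ q := fun w => H.restrict (V.filter fun u => dist w u < 2 * H.range)
  set f : ℝ → I → Op Λ q := fun s i => Real.exp ‖i.1‖ •
    heisenberg (-(H.restrict V - near i)) s ⁅H.term i, heisenberg (H.restrict V) s B⁆ with hf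
  set f' : ℝ → I → Op Λ q := fun s i => Real.exp ‖i.1‖ •
    heisenberg (-(H.restrict V - near i)) s
      (Complex.I • ⁅H.term i, ⁅near i, heisenberg (H.restrict V) s B⁆⁆)
  have hsa : ∀ w, IsSelfAdjoint (near w) := fun w => H.isSelfAdjoint_restrict _
  have hcomm : ∀ w : Λ, ⁅H.term w, H.restrict V - near w⁆ = 0 := fun w => by
    refine H.lie_restrict_sub_filter V (H.supported w) _ fun u hu => ?_
    rw [Set.disjoint_left]
    intro x hx hx'
    simp only [Set.mem_ofPred_eq] at hx hx'
    have := dist_triangle_left w u x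
    linarith
  have hderiv : ∀ s, HasDerivAt f (f' s) s := fun s => by
    refine hasDerivAt_pi.2 fun i => ?_
    have h := hasDerivAt_heisenberg_lie B (hcomm i) s
    exact h.const_smul (Real.exp ‖i.1‖)
  have hnorm : ∀ s (i : I), ‖f s i‖ =
      Real.exp ‖i.1‖ * ‖⁅H.term i, heisenberg (H.restrict V) s B⁆‖ := fun s i => by
    rw [hf, norm_smul, Real.norm_of_nonneg (Real.exp_pos _).le,
      norm_heisenberg ((H.isSelfAdjoint_restrict V).sub (hsa i)).neg]
  have hbound : ∀ s, ‖f' s‖ ≤ 2 * J * N * ‖f s‖ + 0 := fun s => by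
    rw [add_zero]
    refine (pi_norm_le_iff_of_nonneg (by positivity)).2 fun i => ?_
    have h₁ : ‖⁅near i, heisenberg (H.restrict V) s B⁆‖ ≤ N * Real.exp (-‖i.1‖) * ‖f s‖ := by
      refine (norm_sum_lie_le _ _ _).trans ?_
      refine le_trans ?_ (mul_le_mul_of_nonneg_right (hN V i) (norm_nonneg _))
      rw [Finset.sum_mul]
      refine Finset.sum_le_sum fun w hw => ?_
      have hw' : w ∈ I := Finset.mem_insert_of_mem (Finset.mem_filter.1 hw).1
      have h₂ := norm_le_pi_norm (f s) ⟨w, hw'⟩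
      rw [hnorm] at h₂
      rw [Real.exp_neg, ← div_eq_inv_mul, le_div_iff₀' (Real.exp_pos _)]
      exact h₂
    rw [norm_smul, Real.norm_of_nonneg (Real.exp_pos _).le]
    calc _ ≤ Real.exp ‖i.1‖ * (2 * ‖H.term i‖ * ‖⁅near i, heisenberg (H.restrict V) s B⁆‖) := by
          gcongr
          exact norm_hasDerivAt_heisenberg_lie_le (H.isSelfAdjoint_restrict V) (hsa i) _ _ _
      _ ≤ Real.exp ‖i.1‖ * (2 * J * (N * Real.exp (-‖i.1‖) * ‖f s‖)) := by
          gcongr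
          exact hJ i
      _ = (Real.exp ‖i.1‖ * Real.exp (-‖i.1‖)) * (2 * J * N * ‖f s‖) := by ring
      _ = _ := by rw [← Real.exp_add, add_neg_cancel, Real.exp_zero, one_mul]
  have hinit : ‖f 0‖ ≤ 2 * J * Real.exp (H.range + r) * ‖B‖ := by
    refine (pi_norm_le_iff_of_nonneg (by positivity)).2 fun i => ?_
    rw [hnorm, heisenberg_zero]
    -- Farther terms miss the support of `B`, so the weight costs at most `exp (range + r)`.
    by_cases hi : ‖i.1‖ ≤ H.range + r
    · calc _ ≤ Real.exp (H.range + r) * (2 * ‖H.term i‖ * ‖B‖) := by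
            gcongr
            exact norm_lie_le _ _
        _ ≤ Real.exp (H.range + r) * (2 * J * ‖B‖) := by
            gcongr
            exact hJ i
        _ = _ := by ring
    · rw [lie_eq_zero_of_disjoint _ (H.supported i) hB, norm_zero, mul_zero]
      · positivity
      · rw [Set.disjoint_left]
        intro x hx hx'
        simp only [Set.mem_ofPred_eq, dist_eq_norm] at hx hx'
        have := norm_sub_norm_le i.1 x
        rw [norm_sub_rev] at this
        linarith
  have hmain := norm_le_gronwallBound_of_norm_deriv_right_le (a := 0) (b := t)
    (fun s _ => (hderiv s).continuousAt.continuousWithinAt)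
    (fun s _ => (hderiv s).hasDerivWithinAt) hinit (fun s _ => hbound s) t ⟨ht, le_rfl⟩
  rw [gronwallBound_ε0, sub_zero] at hmain
  have h₁ := (norm_le_pi_norm (f t) ⟨z, Finset.mem_insert_self _ _⟩).trans hmain
  rw [hnorm, ← le_div_iff₀' (Real.exp_pos _)] at h₁
  rwa [Real.exp_sub, ← mul_div_assoc]

variable [DiscreteTopology Λ]

variable (Λ) in
theorem summable_exp_neg_norm : Summable fun z : Λ => Real.exp (-‖z‖) := by
  set k := Module.finrank ℤ Λ + 1
  have h := (ZLattice.summable_norm_pow_inv Λ k (Nat.lt_succ_self _)).mul_left (k.factorial : ℝ)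
  refine h.of_norm_bounded_eventually ?_
  -- The comparison with `k! / ‖z‖ ^ k` fails at `z = 0`, where the inverse is `0`.
  refine (Set.finite_singleton (0 : Λ)).subset fun z hz => ?_
  by_contra hz0
  refine hz ?_
  have hpos : 0 < ‖z‖ := norm_pos_iff.2 hz0
  have hle := Real.pow_div_factorial_le_exp ‖z‖ hpos.le k
  change ‖Real.exp (-‖z‖)‖ ≤ _
  rw [Real.norm_of_nonneg (Real.exp_pos _).le, Real.exp_neg]
  rw [div_le_iff₀ (by positivity)] at hle
  have : ((‖z‖ ^ k)⁻¹ : ℝ) * ‖z‖ ^ k = 1 := inv_mul_cancel₀ (by positivity)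
  rw [inv_le_iff_one_le_mul₀ (Real.exp_pos _)]
  calc (1 : ℝ) = (‖z‖ ^ k)⁻¹ * ‖z‖ ^ k := this.symm
    _ ≤ (‖z‖ ^ k)⁻¹ * (Real.exp ‖z‖ * k.factorial) := by gcongr
    _ = _ := by ring

open Classical in
variable (Λ) in
theorem exists_sum_near_exp_neg_norm_le (ρ : ℝ) : ∃ N : ℝ, 0 ≤ N ∧ ∀ (V : Finset Λ) (z : Λ),
    ∑ w ∈ V with dist z w < ρ, Real.exp (-‖w‖) ≤ N * Real.exp (-‖z‖) := by
  have hs := summable_exp_neg_norm Λ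
  -- One `ρ` pays for replacing `‖w‖` by `‖z‖`, the other for the factor `exp (-‖w - z‖)`, whose sum
  -- does not depend on `z`.
  refine ⟨Real.exp (2 * ρ) * ∑' w : Λ, Real.exp (-‖w‖),
    mul_nonneg (Real.exp_pos _).le (tsum_nonneg fun _ => (Real.exp_pos _).le), fun V z => ?_⟩
  have hsz : Summable fun w : Λ => Real.exp (-‖w - z‖) :=
    hs.comp_injective (Equiv.subRight z).injective
  have htz : ∑' w : Λ, Real.exp (-‖w - z‖) = ∑' w : Λ, Real.exp (-‖w‖) :=
    (Equiv.subRight z).tsum_eq fun w : Λ => Real.exp (-‖w‖)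
  calc ∑ w ∈ V with dist z w < ρ, Real.exp (-‖w‖)
      ≤ ∑ w ∈ V with dist z w < ρ,
          Real.exp (2 * ρ) * Real.exp (-‖z‖) * Real.exp (-‖w - z‖) := by
        refine Finset.sum_le_sum fun w hw => ?_
        have hd := (Finset.mem_filter.1 hw).2
        rw [dist_eq_norm] at hd
        rw [← Real.exp_add, ← Real.exp_add, Real.exp_le_exp]
        have h₁ : ‖z‖ ≤ ‖z - w‖ + ‖w‖ := by simpa using norm_add_le (z - w) w
        rw [norm_sub_rev w z]
        linarith
    _ = Real.exp (2 * ρ) * Real.exp (-‖z‖) * ∑ w ∈ V with dist z w < ρ, Real.exp (-‖w - z‖) := by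
        rw [Finset.mul_sum]
    _ ≤ Real.exp (2 * ρ) * Real.exp (-‖z‖) * ∑' w : Λ, Real.exp (-‖w - z‖) := by
        gcongr
        exact hsz.sum_le_tsum _ fun _ _ => (Real.exp_pos _).le
    _ = _ := by rw [htz]; ring

/-- The Lieb-Robinson bound for the commutator of a term of the Hamiltonian with an evolved local
operator, uniformly in the finite volume. -/
theorem Hamiltonian.exists_norm_lie_term_heisenberg_le (H : Hamiltonian Λ q) (r : ℝ) :
    ∃ D K : ℝ, 0 ≤ D ∧ 0 ≤ K ∧ ∀ B : Op Λ q, IsSupportedOn {x : Λ | ‖x‖ ≤ r} B →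
      ∀ (V : Finset Λ) (t : ℝ) (z : Λ),
        ‖⁅H.term z, heisenberg (H.restrict V) t B⁆‖ ≤ D * ‖B‖ * Real.exp (K * |t| - ‖z‖) := by
  obtain ⟨J, hJ⟩ := H.bounded
  obtain ⟨N, hN₀, hN⟩ := exists_sum_near_exp_neg_norm_le Λ (2 * H.range)
  have hJ₀ : 0 ≤ J := (norm_nonneg _).trans (hJ 0)
  refine ⟨2 * J * Real.exp (H.range + r), 2 * J * N, by positivity, by positivity,
    fun B hB V t z => ?_⟩
  rcases le_total 0 t with ht | ht
  · rw [abs_of_nonneg ht]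
    exact H.norm_lie_term_heisenberg_le_of_nonneg hJ hN₀ hN hB V ht z
  · have h := H.neg.norm_lie_term_heisenberg_le_of_nonneg (fun z => (norm_neg _).trans_le (hJ z))
      hN₀ hN hB V (neg_nonneg.2 ht) z
    rw [H.restrict_neg, heisenberg_neg, neg_neg] at h
    rw [abs_of_nonpos ht]
    refine le_trans (le_of_eq ?_) h
    change _ = ‖⁅-H.term z, _⁆‖
    rw [Ring.lie_def, Ring.lie_def, ← norm_neg]
    congr 1
    noncomm_ring

end LiebRobinson

/-! ### Infinite-volume evolution and commutator bound -/

section Evolution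

variable {d : ℕ} {Λ : Submodule ℤ (Space d)} {q : ℕ} [NeZero q]

theorem Hamiltonian.evolveIn_eq (H : Hamiltonian Λ q) (V : Finset Λ) (t : ℝ) (A : Op Λ q) :
    H.evolveIn V t A = heisenberg (H.restrict V) t A := rfl

theorem abs_le_of_mem_uIcc {s t : ℝ} (hs : s ∈ Set.uIcc 0 t) : |s| ≤ |t| := by
  simpa using Set.abs_sub_left_of_mem_uIcc hs

/-- Duhamel estimate comparing the evolutions in two finite volumes. -/
theorem Hamiltonian.norm_evolveIn_sub_le (H : Hamiltonian Λ q) {W V : Finset Λ} (hWV : W ⊆ V)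
    (A : Op Λ q) {t : ℝ} {c : Λ → ℝ}
    (hc : ∀ s, |s| ≤ |t| → ∀ z, ‖⁅H.term z, heisenberg (H.restrict W) s A⁆‖ ≤ c z) :
    ‖H.evolveIn W t A - H.evolveIn V t A‖ ≤ (∑ z ∈ V \ W, c z) * |t| := by
  set K := H.restrict V
  set L := H.restrict W
  have hK := H.isSelfAdjoint_restrict V
  have h := (convex_uIcc (0 : ℝ) t).norm_image_sub_le_of_norm_hasDerivWithin_le
    (f := fun s => heisenberg (-K) s (heisenberg L s A)) (C := ∑ z ∈ V \ W, c z)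
    (fun s _ => (hasDerivAt_heisenberg_heisenberg L K A s).hasDerivWithinAt) (fun s hs => ?_)
    Set.left_mem_uIcc Set.right_mem_uIcc
  · simp only [heisenberg_zero, sub_zero, Real.norm_eq_abs] at h
    rwa [← heisenberg_neg_heisenberg K t A, ← heisenberg_sub, heisenberg_neg_heisenberg,
      norm_heisenberg hK.neg] at h
  · rw [norm_heisenberg hK.neg, norm_smul, Complex.norm_I, one_mul]
    have e : L - K = -∑ z ∈ V \ W, H.term z := by
      rw [← neg_sub, neg_inj, sub_eq_iff_eq_add]
      exact (Finset.sum_sdiff hWV).symm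
    have e' : ‖⁅L - K, heisenberg L s A⁆‖ = ‖⁅∑ z ∈ V \ W, H.term z, heisenberg L s A⁆‖ := by
      rw [e, Ring.lie_def, Ring.lie_def, ← norm_neg]
      congr 1
      noncomm_ring
    rw [e']
    exact (norm_sum_lie_le _ _ _).trans
      (Finset.sum_le_sum fun z _ => hc s (abs_le_of_mem_uIcc hs) z)

theorem norm_heisenberg_sub_le {𝔸 : Type*} [CStarAlgebra 𝔸] {H : 𝔸} (hH : IsSelfAdjoint H)
    (A : 𝔸) (s t : ℝ) :
    ‖heisenberg H t A - heisenberg H s A‖ ≤ ‖⁅H, A⁆‖ * ‖t - s‖ :=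
  convex_univ.norm_image_sub_le_of_norm_hasDerivWithin_le
    (fun s _ => (hasDerivAt_heisenberg H A s).hasDerivWithinAt)
    (fun s _ => by rw [norm_heisenberg hH, norm_smul, Complex.norm_I, one_mul])
    (Set.mem_univ s) (Set.mem_univ t)

variable [DiscreteTopology Λ]

/-- The evolution of a local operator on the infinite lattice exists. -/
theorem Hamiltonian.tendsto_evolveIn (H : Hamiltonian Λ q) {A : Op Λ q} (hA : IsLocal A) (t : ℝ) :
    Tendsto (fun V : Finset Λ => H.evolveIn V t A) atTop (𝓝 (H.evolve t A)) := by
  obtain ⟨r, hr⟩ := hA.exists_norm_le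
  obtain ⟨D, K, hD, hK, hDK⟩ := H.exists_norm_lie_term_heisenberg_le r
  set c : Λ → ℝ := fun z => D * ‖A‖ * Real.exp (K * |t|) * Real.exp (-‖z‖)
  have hsum : Summable c := (summable_exp_neg_norm Λ).mul_left _
  have hle : ∀ {W V : Finset Λ}, W ⊆ V →
      ‖H.evolveIn W t A - H.evolveIn V t A‖ ≤ (∑ z ∈ V \ W, c z) * |t| := fun hWV =>
    H.norm_evolveIn_sub_le hWV A fun s hs z => by
      refine (hDK A hr _ s z).trans ?_
      change _ ≤ D * ‖A‖ * Real.exp (K * |t|) * Real.exp (-‖z‖)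
      rw [mul_assoc _ (Real.exp _), ← Real.exp_add, ← sub_eq_add_neg]
      gcongr
  refine CauchySeq.tendsto_limUnder (Metric.cauchySeq_iff'.2 fun ε hε => ?_)
  obtain ⟨W, hW⟩ := summable_iff_vanishing_norm.1 hsum (ε / (|t| + 1)) (by positivity)
  refine ⟨W, fun V hV => ?_⟩
  rw [dist_comm, dist_eq_norm]
  have h := hW (V \ W) Finset.sdiff_disjoint
  rw [lt_div_iff₀ (by positivity)] at h
  have h' := Real.le_norm_self (∑ z ∈ V \ W, c z)
  calc _ ≤ (∑ z ∈ V \ W, c z) * |t| := hle hV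
    _ ≤ ‖∑ z ∈ V \ W, c z‖ * (|t| + 1) := by gcongr; simp
    _ < ε := h

theorem Hamiltonian.norm_evolve (H : Hamiltonian Λ q) {A : Op Λ q} (hA : IsLocal A) (t : ℝ) :
    ‖H.evolve t A‖ = ‖A‖ := by
  refine tendsto_nhds_unique (H.tendsto_evolveIn hA t).norm ?_
  simp only [H.evolveIn_eq, norm_heisenberg (H.isSelfAdjoint_restrict _)]
  exact tendsto_const_nhds

/-- The norms `‖⁅H_V, A⁆‖` are bounded uniformly in `V` (the Lieb-Robinson bound at time `0`, summed
over sites), so a common Lipschitz constant survives the limit. -/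
theorem Hamiltonian.continuous_evolve (H : Hamiltonian Λ q) {A : Op Λ q} (hA : IsLocal A) :
    Continuous fun t => H.evolve t A := by
  obtain ⟨r, hr⟩ := hA.exists_norm_le
  obtain ⟨D, K, hD, hK, hDK⟩ := H.exists_norm_lie_term_heisenberg_le r
  let L : ℝ := ∑' z : Λ, D * ‖A‖ * Real.exp (-‖z‖)
  have hsum : Summable fun z : Λ => D * ‖A‖ * Real.exp (-‖z‖) :=
    (summable_exp_neg_norm Λ).mul_left _
  have hL : ∀ V : Finset Λ, ‖⁅H.restrict V, A⁆‖ ≤ L := fun V => by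
    refine (norm_sum_lie_le _ _ _).trans ?_
    refine le_trans (Finset.sum_le_sum fun z _ => ?_)
      (hsum.sum_le_tsum V fun _ _ => by positivity)
    simpa using hDK A hr V 0 z
  have hV : ∀ (V : Finset Λ) (s t : ℝ), ‖H.evolveIn V t A - H.evolveIn V s A‖ ≤ L * ‖t - s‖ :=
    fun V s t => (norm_heisenberg_sub_le (H.isSelfAdjoint_restrict V) A s t).trans
      (mul_le_mul_of_nonneg_right (hL V) (norm_nonneg _))
  have hlim : ∀ s t : ℝ, ‖H.evolve t A - H.evolve s A‖ ≤ L * ‖t - s‖ := fun s t =>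
    le_of_tendsto ((H.tendsto_evolveIn hA t).sub (H.tendsto_evolveIn hA s)).norm
      (Eventually.of_forall fun V => hV V s t)
  have hL₀ : 0 ≤ L := (norm_nonneg _).trans (hL ∅)
  refine (LipschitzWith.of_dist_le_mul (K := ⟨L, hL₀⟩) fun t s => ?_).continuous
  rw [dist_eq_norm, dist_eq_norm]
  exact hlim s t

theorem Hamiltonian.continuous_commutator (H : Hamiltonian Λ q) {A : Op Λ q} (hA : IsLocal A)
    (B : Op Λ q) (y : Λ) : Continuous fun t => H.commutator A B t y :=
  ((H.continuous_evolve hA).mul continuous_const).sub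
    (continuous_const.mul (H.continuous_evolve hA))

theorem Hamiltonian.norm_commutator_le (H : Hamiltonian Λ q) {A : Op Λ q} (hA : IsLocal A)
    (B : Op Λ q) (t : ℝ) (y : Λ) : ‖H.commutator A B t y‖ ≤ 2 * ‖A‖ * ‖B‖ := by
  refine (norm_lie_le (H.evolve t A) (translate y B)).trans ?_
  rw [H.norm_evolve hA]
  gcongr
  exact norm_translate_le y B

open Classical in
/-- The Lieb-Robinson bound on the infinite lattice. -/
theorem Hamiltonian.exists_norm_commutator_le (H : Hamiltonian Λ q) {A B : Op Λ q}
    (hA : IsLocal A) (hB : IsLocal B) : ∃ C v : ℝ, 0 < C ∧ 0 < v ∧ ∀ (t : ℝ) (y : Λ), 0 ≤ t →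
      ‖H.commutator A B t y‖ ≤ C * ‖A‖ * ‖B‖ * Real.exp (v * t - ‖y‖) := by
  obtain ⟨r, hr⟩ := hA.exists_norm_le
  obtain ⟨r', hr'⟩ := hB.exists_norm_le
  obtain ⟨D, K, hD, hK, hDK⟩ := H.exists_norm_lie_term_heisenberg_le r
  obtain ⟨N, hN₀, hN⟩ := exists_sum_near_exp_neg_norm_le Λ (r' + H.range)
  -- The summands come from the commutator at time `0` and from its growth; `K + 1` absorbs the
  -- elapsed time through `t ≤ exp t`.
  refine ⟨2 * Real.exp (r + r') + 2 * D * N, K + 1, by positivity, by positivity,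
    fun t y ht => ?_⟩
  set Y := translate y B
  have hYB : ‖Y‖ ≤ ‖B‖ := norm_translate_le y B
  have hY : IsSupportedOn {x : Λ | ‖x - y‖ ≤ r'} Y := hr'.translate y
  set near : Finset Λ → Op Λ q := fun V => H.restrict (V.filter fun u => dist y u < r' + H.range)
  have hcomm : ∀ V : Finset Λ, ⁅Y, H.restrict V - near V⁆ = 0 := fun V => by
    refine H.lie_restrict_sub_filter V hY _ fun u hu => ?_
    rw [Set.disjoint_left]
    intro x hx hx'
    simp only [Set.mem_ofPred_eq, ← dist_eq_norm] at hx hx'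
    have := dist_triangle_left y u x
    linarith
  have hnear : ∀ (V : Finset Λ) (s : ℝ), |s| ≤ |t| →
      ‖⁅near V, heisenberg (H.restrict V) s A⁆‖ ≤
        D * ‖A‖ * Real.exp (K * t) * (N * Real.exp (-‖y‖)) := fun V s hs => by
    refine (norm_sum_lie_le _ _ _).trans ?_
    refine le_trans ?_ (mul_le_mul_of_nonneg_left (hN V y) (by positivity))
    rw [Finset.mul_sum]
    refine Finset.sum_le_sum fun z _ => (hDK A hr V s z).trans ?_
    rw [mul_assoc _ (Real.exp _), ← Real.exp_add, ← sub_eq_add_neg]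
    rw [abs_of_nonneg ht] at hs
    gcongr
  have h₀ : ‖⁅Y, A⁆‖ ≤ 2 * Real.exp (r + r') * ‖A‖ * ‖B‖ * Real.exp (-‖y‖) := by
    by_cases hy : ‖y‖ ≤ r + r'
    · calc ‖⁅Y, A⁆‖ ≤ 2 * ‖Y‖ * ‖A‖ := norm_lie_le _ _
        _ ≤ 2 * ‖B‖ * ‖A‖ * 1 := by rw [mul_one]; gcongr
        _ ≤ 2 * ‖B‖ * ‖A‖ * Real.exp (r + r' - ‖y‖) := by
            gcongr
            exact Real.one_le_exp (by linarith)
        _ = _ := by rw [sub_eq_add_neg, Real.exp_add (r + r')]; ring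
    · rw [lie_eq_zero_of_disjoint _ hY hr, norm_zero]
      · positivity
      · rw [Set.disjoint_left]
        intro x hx hx'
        simp only [Set.mem_ofPred_eq] at hx hx'
        have := norm_sub_norm_le y x
        rw [norm_sub_rev] at this
        linarith
  have hV : ∀ V : Finset Λ, ‖⁅Y, H.evolveIn V t A⁆‖ ≤
      (2 * Real.exp (r + r') + 2 * D * N) * ‖A‖ * ‖B‖ * Real.exp ((K + 1) * t - ‖y‖) := fun V => by
    have hsa := H.isSelfAdjoint_restrict V
    have hsa' : IsSelfAdjoint (near V) := H.isSelfAdjoint_restrict _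
    have h := (convex_uIcc (0 : ℝ) t).norm_image_sub_le_of_norm_hasDerivWithin_le
      (C := 2 * ‖B‖ * (D * ‖A‖ * Real.exp (K * t) * (N * Real.exp (-‖y‖))))
      (fun s _ => (hasDerivAt_heisenberg_lie A (hcomm V) s).hasDerivWithinAt) (fun s hs => ?_)
      Set.left_mem_uIcc Set.right_mem_uIcc
    · simp only [heisenberg_zero, sub_zero, Real.norm_eq_abs, abs_of_nonneg ht] at h
      have h₁ := (norm_sub_norm_le _ _).trans h
      rw [norm_heisenberg (hsa.sub hsa').neg] at h₁
      have ht' : t ≤ Real.exp t := by linarith [Real.add_one_le_exp t]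
      have e₁ : (1 : ℝ) ≤ Real.exp (K * t + t) := Real.one_le_exp (by positivity)
      calc ‖⁅Y, H.evolveIn V t A⁆‖
          ≤ ‖⁅Y, A⁆‖ + 2 * ‖B‖ * (D * ‖A‖ * Real.exp (K * t) * (N * Real.exp (-‖y‖))) * t := by
            rw [H.evolveIn_eq]; linarith
        _ ≤ 2 * Real.exp (r + r') * ‖A‖ * ‖B‖ * Real.exp (-‖y‖) * Real.exp (K * t + t) +
            2 * ‖B‖ * (D * ‖A‖ * Real.exp (K * t) * (N * Real.exp (-‖y‖))) * Real.exp t := by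
            refine add_le_add (h₀.trans (le_mul_of_one_le_right (by positivity) e₁)) ?_
            gcongr
        _ = _ := by
            rw [show (K + 1) * t - ‖y‖ = (K * t + t) + -‖y‖ by ring,
              Real.exp_add (K * t + t), Real.exp_add (K * t)]
            ring
    · refine (norm_hasDerivAt_heisenberg_lie_le hsa hsa' _ _ _).trans ?_
      gcongr
      exact hnear V s (abs_le_of_mem_uIcc hs)
  have hlim := ((tendsto_const_nhds (x := Y)).mul (H.tendsto_evolveIn hA t)).sub
    ((H.tendsto_evolveIn hA t).mul (tendsto_const_nhds (x := Y)))
  refine (norm_sub_rev _ _).trans_le (le_of_tendsto hlim.norm (Eventually.of_forall hV))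

end Evolution

/-! ### Comparison of the two velocities -/

section VelocityBounds

variable {d : ℕ} {Λ : Submodule ℤ (Space d)} {q : ℕ} [NeZero q]
  {H : Hamiltonian Λ q} {X : Set ℝ} {p : ℝ → Λ} {O₁ O₂ : Op Λ q}

theorem growthRate_le_iff {v t : ℝ} (ht : 0 < t) (a : ℝ) :
    growthRate H p O₁ O₂ v t ≤ (a : EReal) ↔
      ‖H.commutator O₁ O₂ t (p (v * t))‖ ≤ Real.exp (a * t) := by
  rw [growthRate, ← ofReal_norm]
  rcases (norm_nonneg (H.commutator O₁ O₂ t (p (v * t)))).eq_or_lt with h | h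
  · rw [← h, ENNReal.ofReal_zero, ENNReal.log_zero, EReal.coe_mul_bot_of_pos (inv_pos.2 ht)]
    simp [(Real.exp_pos _).le]
  · rw [ENNReal.log_ofReal_of_pos h, ← EReal.coe_mul, EReal.coe_le_coe_iff,
      ← Real.log_le_iff_le_exp h, inv_mul_le_iff₀ ht, mul_comm t]

theorem growthRate_lt_top {v t : ℝ} (ht : 0 < t) : growthRate H p O₁ O₂ v t < ⊤ := by
  refine lt_of_le_of_lt ((growthRate_le_iff ht
    (Real.log (‖H.commutator O₁ O₂ t (p (v * t))‖ + 1) / t)).2 ?_) (EReal.coe_lt_top _)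
  rw [div_mul_cancel₀ _ ht.ne', Real.exp_log (by positivity)]
  linarith

theorem exists_le_mul_mem (hX : ¬ BddAbove X) {v : ℝ} (hv : 0 < v) (T : ℝ) :
    ∃ t, T ≤ t ∧ v * t ∈ X := by
  obtain ⟨x, hx, hlt⟩ := not_bddAbove_iff.1 hX (v * T)
  refine ⟨x / v, ?_, ?_⟩
  · rw [le_div_iff₀' hv]
    exact hlt.le
  · rwa [mul_div_cancel₀ _ hv.ne']

/-- With a trivial filter every `l` would be a ray limit. -/
theorem neBot_atTop_inf_principal (hX : ¬ BddAbove X) {v : ℝ} (hv : 0 < v) :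
    (atTop ⊓ 𝓟 {t | v * t ∈ X}).NeBot := by
  rw [← frequently_mem_iff_neBot, frequently_atTop]
  exact exists_le_mul_mem hX hv

theorem velocity₂_le_velocity₁ (hX : ¬ BddAbove X) :
    velocity₂ H X p O₁ O₂ ≤ velocity₁ H X p O₁ O₂ := by
  refine iSup₂_le fun w hw => le_iInf₂ fun v hv => ?_
  obtain ⟨hw₀, l, hl, hl₀⟩ := hw
  obtain ⟨-, ξ, C, hξ, hC, h⟩ := hv
  refine ENNReal.ofReal_le_ofReal ?_
  by_contra! hvw
  have : (atTop ⊓ 𝓟 {t | w * t ∈ X}).NeBot := neBot_atTop_inf_principal hX hw₀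
  set M := C * ‖O₁‖ * ‖O₂‖ + 1
  have hM : 0 < M := by positivity
  -- Half of the decay exponent; the other half absorbs the prefactor `M` at large times.
  set a := (v - w) / (2 * ξ)
  have ha : a < 0 := div_neg_of_neg_of_pos (by linarith) (by linarith)
  refine (lt_of_le_of_lt (hl₀.trans (le_of_tendsto hl ?_ : l ≤ (a : EReal)))
    (EReal.coe_lt_coe_iff.2 ha)).false
  have hev : ∀ᶠ t : ℝ in atTop, 0 < t ∧ Real.log M ≤ -a * t :=
    (eventually_gt_atTop 0).and
      ((tendsto_id.const_mul_atTop (neg_pos.2 ha)).eventually_ge_atTop _)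
  filter_upwards [hev.filter_mono inf_le_left,
    (mem_inf_of_right (mem_principal_self _) : {t | w * t ∈ X} ∈ atTop ⊓ 𝓟 {t | w * t ∈ X})]
    with t ht htX
  refine (growthRate_le_iff ht.1 a).2 ((h t (w * t) ht.1 (mul_pos hw₀ ht.1) htX).trans ?_)
  have e : (v * t - w * t) / ξ = 2 * (a * t) := by
    simp only [a]
    field_simp
  calc C * ‖O₁‖ * ‖O₂‖ * min 1 (Real.exp ((v * t - w * t) / ξ))
      ≤ M * Real.exp ((v * t - w * t) / ξ) := by
        gcongr
        · simp [M]
        · exact min_le_right _ _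
    _ = Real.exp (Real.log M + 2 * (a * t)) := by rw [Real.exp_add, Real.exp_log hM, e]
    _ ≤ Real.exp (a * t) := Real.exp_le_exp.2 (by linarith [ht.2])

/-- Where the limiting rate is nonnegative, uniform convergence implies convergence in the
extended reals. -/
theorem hasRayLimit_of_uniformRayLimit (hX : ¬ BddAbove X) {W : Set ℝ} {lam : ℝ → EReal}
    (h : UniformRayLimit H X p O₁ O₂ W lam) {v : ℝ} (hv : 0 < v) (hvW : v ∈ W)
    (hlam : 0 ≤ lam v) : HasRayLimit H X p O₁ O₂ v (lam v) := by
  have key : ∀ ε : ℝ, 0 < ε → ∃ T : ℝ, 0 < T ∧ ∀ t, T ≤ t → v * t ∈ X →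
      growthRate H p O₁ O₂ v t ≤ lam v + (ε : EReal) ∧
      lam v ≤ growthRate H p O₁ O₂ v t + (ε : EReal) := fun ε hε => by
    obtain ⟨T, hT, hTt⟩ := h ε hε
    -- The cutoff `-1 / ε` is negative, so it plays no role when the limiting rate is nonnegative.
    have hneg : ((-1 / ε : ℝ) : EReal) < 0 := by
      exact_mod_cast div_neg_of_neg_of_pos (by norm_num : (-1 : ℝ) < 0) hε
    have hε' : (0 : EReal) ≤ (ε : EReal) := by exact_mod_cast hε.le
    refine ⟨T, hT, fun t ht htX => ?_⟩
    obtain ⟨h₁, h₂⟩ := hTt t ht v hvW htX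
    refine ⟨h₁.trans (max_le le_rfl (hneg.le.trans (add_nonneg hlam hε'))), ?_⟩
    rcases le_max_iff.1 h₂ with h₂ | h₂
    · exact h₂
    · exact absurd (hlam.trans h₂) (not_le.2 hneg)
  have htop : lam v < ⊤ := by
    obtain ⟨T, hT, hTt⟩ := key 1 one_pos
    obtain ⟨t, ht, htX⟩ := exists_le_mul_mem hX hv T
    exact (hTt t ht htX).2.trans_lt
      (EReal.add_lt_top (growthRate_lt_top (hT.trans_le ht)).ne (EReal.coe_ne_top _))
  lift lam v to ℝ using ⟨htop.ne, fun hb => by simp [hb] at hlam⟩ with L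
  have hev : ∀ ε : ℝ, 0 < ε → ∀ᶠ t in atTop ⊓ 𝓟 {t | v * t ∈ X},
      growthRate H p O₁ O₂ v t ≤ (L : EReal) + (ε : EReal) ∧
      (L : EReal) ≤ growthRate H p O₁ O₂ v t + (ε : EReal) := fun ε hε => by
    obtain ⟨T, -, hTt⟩ := key ε hε
    rw [eventually_inf_principal]
    filter_upwards [eventually_ge_atTop T] with t ht htX using hTt t ht htX
  refine tendsto_order.2 ⟨fun a ha => ?_, fun b hb => ?_⟩
  · obtain ⟨a', haa', ha'⟩ := EReal.lt_iff_exists_real_btwn.1 ha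
    rw [EReal.coe_lt_coe_iff] at ha'
    filter_upwards [hev ((L - a') / 2) (by linarith)] with t ht
    refine haa'.trans ?_
    by_contra! hle
    have h₁ : (L : EReal) ≤ (a' : EReal) + ((L - a') / 2 : ℝ) := ht.2.trans (by gcongr)
    rw [← EReal.coe_add, EReal.coe_le_coe_iff] at h₁
    linarith
  · obtain ⟨b', hb', hbb'⟩ := EReal.lt_iff_exists_real_btwn.1 hb
    rw [EReal.coe_lt_coe_iff] at hb'
    filter_upwards [hev (b' - L) (by linarith)] with t ht
    refine (ht.1.trans_eq ?_).trans_lt hbb'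
    rw [← EReal.coe_add, add_sub_cancel]

theorem pos_of_velocity₂_lt {v : ℝ} (hv : velocity₂ H X p O₁ O₂ < ENNReal.ofReal v) : 0 < v :=
  ENNReal.ofReal_pos.1 (bot_le.trans_lt hv)

theorem rate_neg_of_velocity₂_lt (hX : ¬ BddAbove X) {lam : ℝ → EReal}
    (h : UniformRayLimit H X p O₁ O₂ {v | velocity₂ H X p O₁ O₂ < ENNReal.ofReal v} lam)
    {v : ℝ} (hv : velocity₂ H X p O₁ O₂ < ENNReal.ofReal v) : lam v < 0 := by
  by_contra! hlam
  have hv₀ := pos_of_velocity₂_lt hv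
  refine hv.not_ge ?_
  exact le_iSup₂_of_le v ⟨hv₀, lam v, hasRayLimit_of_uniformRayLimit hX h hv₀ hv hlam, hlam⟩ le_rfl

variable [DiscreteTopology Λ]

theorem exists_liebRobinsonBound (H : Hamiltonian Λ q) {n : Space d} (hn : ‖n‖ = 1)
    (hp : ∃ K : ℝ, ∀ x ∈ X, ‖(p x : Space d) - x • n‖ ≤ K)
    (hO₁ : IsLocal O₁) (hO₂ : IsLocal O₂) :
    ∃ v : ℝ, 0 < v ∧ LiebRobinsonBound H X p O₁ O₂ v := by
  obtain ⟨K, hK⟩ := hp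
  obtain ⟨C, v, hC, hv, h⟩ := H.exists_norm_commutator_le hO₁ hO₂
  refine ⟨v, hv, 1, 2 + C * Real.exp K, one_pos, by positivity, fun t x ht hx hxX => ?_⟩
  rw [div_one, mul_min_of_nonneg _ _ (by positivity), mul_one]
  refine le_min ?_ ?_
  · calc _ ≤ 2 * ‖O₁‖ * ‖O₂‖ := H.norm_commutator_le hO₁ O₂ t (p x)
      _ ≤ _ := by
        gcongr
        exact le_add_of_nonneg_right (by positivity)
  · have hpx : x - K ≤ ‖p x‖ := by
      have h₁ := norm_sub_norm_le (x • n) (p x : Space d)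
      rw [norm_sub_rev, norm_smul, hn, mul_one, Real.norm_of_nonneg hx.le] at h₁
      have h₂ := hK x hxX
      rw [Submodule.coe_norm]
      linarith
    calc _ ≤ C * ‖O₁‖ * ‖O₂‖ * Real.exp (v * t - ‖p x‖) := h t (p x) ht.le
      _ ≤ C * ‖O₁‖ * ‖O₂‖ * Real.exp (K + (v * t - x)) := by
        gcongr
        linarith
      _ = C * Real.exp K * ‖O₁‖ * ‖O₂‖ * Real.exp (v * t - x) := by rw [Real.exp_add]; ring
      _ ≤ _ := by
        gcongr
        exact le_add_of_nonneg_left two_pos.le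

/-- The limiting rate is bounded away from zero near every velocity above `velocity₂`. -/
theorem exists_eventually_rate_le (hX : ¬ BddAbove X) (hO₁ : IsLocal O₁) {lam : ℝ → EReal}
    (h : UniformRayLimit H X p O₁ O₂ {v | velocity₂ H X p O₁ O₂ < ENNReal.ofReal v} lam)
    {w : ℝ} (hw : velocity₂ H X p O₁ O₂ < ENNReal.ofReal w) :
    ∃ ε : ℝ, 0 < ε ∧ ∀ᶠ u in 𝓝 w, lam u ≤ ((-ε : ℝ) : EReal) := by
  have hw₀ := pos_of_velocity₂_lt hw
  obtain ⟨c, hc, hc₀⟩ := EReal.lt_iff_exists_real_btwn.1 (rate_neg_of_velocity₂_lt hX h hw)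
  have hc₀ : c < 0 := by exact_mod_cast hc₀
  -- Budget `c ≤ -4ε`: one `ε` each for passing from the limit to a finite time, moving to nearby
  -- rays, and returning to the limit. The bound `1 / 2` keeps the cutoff `-1 / ε` below `-3ε`.
  set ε := min (-c / 4) (1 / 2)
  have hε : 0 < ε := lt_min (by linarith) (by norm_num)
  have hε₁ : ε ≤ -c / 4 := min_le_left _ _
  have hε₂ : ε ≤ 1 / 2 := min_le_right _ _
  have hε₃ : -1 / ε ≤ -3 * ε := by
    rw [div_le_iff₀ hε]
    nlinarith
  obtain ⟨T, hT, hTt⟩ := h ε hε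
  obtain ⟨t, ht, htX⟩ := exists_le_mul_mem hX hw₀ (T + 1)
  have ht₀ : 0 < t := by linarith
  -- The point stays fixed and the time varies as `x / u`, since `p` need not be continuous.
  set x := w * t
  have hrate : growthRate H p O₁ O₂ w t ≤ ((-3 * ε : ℝ) : EReal) := by
    refine (hTt t (by linarith) w hw htX).1.trans (max_le ?_ (EReal.coe_le_coe_iff.2 hε₃))
    calc lam w + (ε : EReal) ≤ (c : EReal) + (ε : EReal) := by gcongr
      _ ≤ _ := by
        rw [← EReal.coe_add, EReal.coe_le_coe_iff]
        linarith
  rw [growthRate_le_iff ht₀] at hrate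
  have hxw : x / w = t := mul_div_cancel_left₀ _ hw₀.ne'
  have hdiv : ContinuousAt (fun u => x / u) w := continuousAt_const.div continuousAt_id hw₀.ne'
  have hcomm : ContinuousAt (fun u => ‖H.commutator O₁ O₂ (x / u) (p x)‖) w :=
    ((H.continuous_commutator hO₁ O₂ (p x)).norm.continuousAt).comp hdiv
  have hexp : ContinuousAt (fun u => Real.exp (-2 * ε * (x / u))) w :=
    Real.continuous_exp.continuousAt.comp (continuousAt_const.mul hdiv)
  have hlt : ‖H.commutator O₁ O₂ (x / w) (p x)‖ < Real.exp (-2 * ε * (x / w)) := by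
    rw [hxw]
    exact hrate.trans_lt (Real.exp_lt_exp.2 (by nlinarith))
  have hTlt : T < x / w := by rw [hxw]; linarith
  have hvel : ∀ᶠ u in 𝓝 w, velocity₂ H X p O₁ O₂ < ENNReal.ofReal u :=
    ENNReal.continuous_ofReal.continuousAt.eventually_const_lt hw
  refine ⟨ε, hε, ?_⟩
  filter_upwards [hcomm.eventually_lt hexp hlt, hdiv.eventually_const_lt hTlt, hvel]
    with u hu hTu hvu
  have hu₀ := pos_of_velocity₂_lt hvu
  have hux : u * (x / u) = x := mul_div_cancel₀ _ hu₀.ne'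
  have hgr : growthRate H p O₁ O₂ u (x / u) ≤ ((-2 * ε : ℝ) : EReal) := by
    rw [growthRate_le_iff (hT.trans hTu), hux]
    exact hu.le
  refine (hTt (x / u) hTu.le u hvu (by rwa [hux])).2.trans (max_le ?_ ?_)
  · calc _ ≤ ((-2 * ε : ℝ) : EReal) + (ε : EReal) := by gcongr
      _ = _ := by rw [← EReal.coe_add]; congr 1; ring
  · rw [EReal.coe_le_coe_iff]
    linarith

/-- On compact intervals of velocities above `velocity₂` the limiting rate is bounded away from
zero. -/
theorem exists_forall_Icc_rate_le (hX : ¬ BddAbove X) (hO₁ : IsLocal O₁) {lam : ℝ → EReal}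
    (h : UniformRayLimit H X p O₁ O₂ {v | velocity₂ H X p O₁ O₂ < ENNReal.ofReal v} lam)
    {v : ℝ} (hv : velocity₂ H X p O₁ O₂ < ENNReal.ofReal v) (v' : ℝ) :
    ∃ ε : ℝ, 0 < ε ∧ ∀ u ∈ Set.Icc v v', lam u ≤ ((-ε : ℝ) : EReal) := by
  refine (isCompact_Icc (a := v) (b := v')).induction_on
    (p := fun s => ∃ ε : ℝ, 0 < ε ∧ ∀ u ∈ s, lam u ≤ ((-ε : ℝ) : EReal))
    ⟨1, one_pos, by simp⟩ ?_ ?_ ?_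
  · rintro s t hst ⟨ε, hε, ht⟩
    exact ⟨ε, hε, fun u hu => ht u (hst hu)⟩
  · rintro s t ⟨ε, hε, hs⟩ ⟨ε', hε', ht⟩
    refine ⟨min ε ε', lt_min hε hε', fun u hu => ?_⟩
    rcases hu with hu | hu
    · exact (hs u hu).trans (EReal.coe_le_coe_iff.2 (neg_le_neg (min_le_left _ _)))
    · exact (ht u hu).trans (EReal.coe_le_coe_iff.2 (neg_le_neg (min_le_right _ _)))
  · intro w hw
    obtain ⟨ε, hε, hev⟩ := exists_eventually_rate_le hX hO₁ h
      (hv.trans_le (ENNReal.ofReal_le_ofReal hw.1))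
    exact ⟨_, mem_nhdsWithin_of_mem_nhds hev, ε, hε, fun u hu => hu⟩

/-- Spacetime splits into `x ≤ v t` (trivial bound), `x ≥ 2 v₀ t` (a priori bound), and the wedge
between: there early times cost a constant, and late times decay like `exp (-ε t)`, which dominates
`x` because `x < 2 v₀ t`. -/
theorem liebRobinsonBound_of_uniformRayLimit (hX : ¬ BddAbove X) (hO₁ : IsLocal O₁) {v₀ : ℝ}
    (hv₀ : 0 < v₀) (h₀ : LiebRobinsonBound H X p O₁ O₂ v₀) {lam : ℝ → EReal}
    (h : UniformRayLimit H X p O₁ O₂ {v | velocity₂ H X p O₁ O₂ < ENNReal.ofReal v} lam)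
    {v : ℝ} (hv : velocity₂ H X p O₁ O₂ < ENNReal.ofReal v) :
    LiebRobinsonBound H X p O₁ O₂ v := by
  have hvpos := pos_of_velocity₂_lt hv
  have htriv := fun t x => H.norm_commutator_le hO₁ O₂ t (p x)
  rcases (by positivity : 0 ≤ ‖O₁‖ * ‖O₂‖).eq_or_lt with h0 | hpos
  · refine ⟨1, 1, one_pos, one_pos, fun t x _ _ _ => (htriv t x).trans ?_⟩
    rw [mul_assoc, mul_assoc 1, ← h0]
    simp
  obtain ⟨ξ₀, C₀, hξ₀, hC₀, hLR⟩ := h₀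
  obtain ⟨δ, hδ, hlam⟩ := exists_forall_Icc_rate_le hX hO₁ h hv (2 * v₀)
  set ε := min (δ / 2) 1
  have hε : 0 < ε := lt_min (by linarith) one_pos
  have hεδ : ε ≤ δ / 2 := min_le_left _ _
  have hε₁ : ε ≤ 1 := min_le_right _ _
  obtain ⟨T, hT, hTt⟩ := h ε hε
  have hdecay : ∀ t u, T ≤ t → u ∈ Set.Icc v (2 * v₀) → u * t ∈ X →
      ‖H.commutator O₁ O₂ t (p (u * t))‖ ≤ Real.exp (-ε * t) := fun t u ht hu huX => by
    rw [← growthRate_le_iff (hT.trans_le ht)]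
    have hvu := hv.trans_le (ENNReal.ofReal_le_ofReal hu.1)
    refine (hTt t ht u hvu huX).1.trans (max_le ?_ ?_)
    · calc _ ≤ ((-δ : ℝ) : EReal) + (ε : EReal) := by
            gcongr
            exact hlam u hu
        _ ≤ _ := by
          rw [← EReal.coe_add, EReal.coe_le_coe_iff]
          linarith
    · rw [EReal.coe_le_coe_iff, div_le_iff₀ hε]
      nlinarith
  -- For `x ≥ 2 v₀ t` one has `v₀ t - x ≤ -x / 2`, whence `2 ξ₀`; in the wedge `ε t ≥ x / ξ` needs
  -- `ξ ≥ 2 v₀ / ε`.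
  set ξ := max (2 * ξ₀) (2 * v₀ / ε)
  have hξ : 0 < ξ := lt_max_of_lt_left (by linarith)
  -- One summand each for the far region, times before `T`, and the late-time decay, which carries
  -- no factor `‖O₁‖ * ‖O₂‖`.
  set C := C₀ + 2 * Real.exp (2 * v₀ * T / ξ) + 1 / (‖O₁‖ * ‖O₂‖)
  have hinv : 0 < 1 / (‖O₁‖ * ‖O₂‖) := by positivity
  have hexp₁ : 1 ≤ Real.exp (2 * v₀ * T / ξ) := Real.one_le_exp (by positivity)
  have hCC₀ : C₀ ≤ C := by simp only [C]; linarith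
  have hCT : 2 * Real.exp (2 * v₀ * T / ξ) ≤ C := by simp only [C]; linarith
  have hCinv : 1 / (‖O₁‖ * ‖O₂‖) ≤ C := by simp only [C]; linarith
  have hC₂ : 2 ≤ C := by linarith
  have hC : 0 < C := by linarith
  refine ⟨ξ, C, hξ, hC, fun t x ht hx hxX => ?_⟩
  have htriv' : ‖H.commutator O₁ O₂ t (p x)‖ ≤ C * ‖O₁‖ * ‖O₂‖ := (htriv t x).trans (by gcongr)
  rw [mul_min_of_nonneg _ _ (by positivity), mul_one]
  refine le_min htriv' ?_
  rcases le_or_gt x (v * t) with hxv | hxv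
  · refine htriv'.trans (le_mul_of_one_le_right (by positivity) (Real.one_le_exp ?_))
    exact div_nonneg (by linarith) hξ.le
  rcases le_or_gt (2 * v₀ * t) x with hx₀ | hx₀
  · calc _ ≤ C₀ * ‖O₁‖ * ‖O₂‖ * min 1 (Real.exp ((v₀ * t - x) / ξ₀)) := hLR t x ht hx hxX
      _ ≤ C * ‖O₁‖ * ‖O₂‖ * Real.exp ((v * t - x) / ξ) := by
        gcongr
        refine (min_le_right _ _).trans (Real.exp_le_exp.2 ?_)
        calc (v₀ * t - x) / ξ₀ ≤ (-x / 2) / ξ₀ := by gcongr; linarith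
          _ = -(x / (2 * ξ₀)) := by field_simp
          _ ≤ -(x / ξ) := by
            gcongr
            exact le_max_left _ _
          _ = -x / ξ := by ring
          _ ≤ _ := by
            gcongr
            linarith [mul_pos hvpos ht]
  have hvt := mul_pos hvpos ht
  rcases lt_or_ge t T with htT | htT
  · calc _ ≤ 2 * ‖O₁‖ * ‖O₂‖ := htriv t x
      _ = 2 * Real.exp (2 * v₀ * T / ξ) * ‖O₁‖ * ‖O₂‖ * Real.exp (-(2 * v₀ * T / ξ)) := by
        rw [Real.exp_neg]
        field_simp
      _ ≤ C * ‖O₁‖ * ‖O₂‖ * Real.exp ((v * t - x) / ξ) := by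
        gcongr
        rw [← neg_div]
        gcongr
        nlinarith
  · have hut : x / t * t = x := div_mul_cancel₀ _ ht.ne'
    have hd := hdecay t (x / t) htT
      ⟨(le_div_iff₀ ht).2 hxv.le, (div_le_iff₀ ht).2 hx₀.le⟩ (by rwa [hut])
    rw [hut] at hd
    have hξε : 2 * v₀ ≤ ε * ξ := by
      rw [← div_le_iff₀' hε]
      exact le_max_right _ _
    calc _ ≤ Real.exp (-ε * t) := hd
      _ ≤ Real.exp ((v * t - x) / ξ) := by
        rw [Real.exp_le_exp, le_div_iff₀ hξ]
        nlinarith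
      _ = 1 / (‖O₁‖ * ‖O₂‖) * (‖O₁‖ * ‖O₂‖) * Real.exp ((v * t - x) / ξ) := by
        rw [one_div, inv_mul_cancel₀ hpos.ne', one_mul]
      _ ≤ C * (‖O₁‖ * ‖O₂‖) * Real.exp ((v * t - x) / ξ) := by gcongr
      _ = _ := by ring

end VelocityBounds

end SpinLattice

end

theorem mainTheorem7 {d : ℕ} (Λ : Submodule ℤ (SpinLattice.Space d)) [DiscreteTopology Λ]
    [IsZLattice ℝ Λ] (q : ℕ) [NeZero q] (H : SpinLattice.Hamiltonian Λ q)
    (n : SpinLattice.Space d) (hn : ‖n‖ = 1)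
    (X : Set ℝ) (hX : ¬ BddAbove X) (p : ℝ → Λ)
    (hp : ∃ K : ℝ, ∀ x ∈ X, ‖(p x : SpinLattice.Space d) - x • n‖ ≤ K)
    (O₁ O₂ : SpinLattice.Op Λ q)
    (hO₁ : SpinLattice.IsLocal O₁) (hO₂ : SpinLattice.IsLocal O₂) :
    (∀ t : ℝ, Tendsto (fun V : Finset Λ => H.evolveIn V t O₁) atTop (𝓝 (H.evolve t O₁))) ∧
    SpinLattice.velocity₁ H X p O₁ O₂ < ⊤ ∧
    SpinLattice.velocity₂ H X p O₁ O₂ ≤ SpinLattice.velocity₁ H X p O₁ O₂ ∧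
    (∀ lam : ℝ → EReal,
      SpinLattice.UniformRayLimit H X p O₁ O₂
        {v : ℝ | SpinLattice.velocity₂ H X p O₁ O₂ < ENNReal.ofReal v} lam →
      SpinLattice.velocity₁ H X p O₁ O₂ ≤ SpinLattice.velocity₂ H X p O₁ O₂ ∧
      SpinLattice.velocity₁ H X p O₁ O₂ = SpinLattice.velocity₂ H X p O₁ O₂) := by
  obtain ⟨v₀, hv₀, hLR⟩ := SpinLattice.exists_liebRobinsonBound H hn hp hO₁ hO₂
  have hle := SpinLattice.velocity₂_le_velocity₁ (H := H) (p := p) (O₁ := O₁) (O₂ := O₂) hX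
  refine ⟨H.tendsto_evolveIn hO₁, (iInf₂_le v₀ ⟨hv₀, hLR⟩).trans_lt ENNReal.ofReal_lt_top, hle,
    fun lam hlam => ?_⟩
  have hge : SpinLattice.velocity₁ H X p O₁ O₂ ≤ SpinLattice.velocity₂ H X p O₁ O₂ := by
    -- Every finite `c` above `velocity₂` itself admits a Lieb-Robinson bound.
    refine le_of_forall_gt_imp_ge_of_dense fun c hc => ?_
    rcases eq_or_ne c ⊤ with rfl | hc'
    · exact le_top
    rw [← ENNReal.ofReal_toReal hc'] at hc ⊢
    exact iInf₂_le _ ⟨SpinLattice.pos_of_velocity₂_lt hc,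
      SpinLattice.liebRobinsonBound_of_uniformRayLimit hX hO₁ hv₀ hLR hlam hc⟩
  exact ⟨hge, hge.antisymm hle⟩
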